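/- Let $\mathcal C$ and $\mathcal D$ be $C^*$-algebras, not necessarily unital, with $\mathcal D\neq 0$. Let $\mathcal C\otimes^{\min}\mathcal D$ be the completion of the algebraic tensor product $\mathcal C\otimes\mathcal D$ with respect to the minimal $C^*$-norm $$\|z\|_{\min}=\sup\left\{\frac{(\varphi\otimes\psi)(w^*z^*zw)^{1/2}}{(\varphi\otimes\psi)(w^*w)^{1/2}} : \varphi\in\mathcal S(\mathcal C),\ \psi\in\mathcal S(\mathcal D),\ w\in\mathcal C\otimes\mathcal D,\ (\varphi\otimes\psi)(w^*w)\neq 0\right\},$$ where $\mathcal S(\cdot)$ denotes the state space and the supremum of the empty set is $0$. For a $*$-subalgebra $\mathcal A$ of $\mathcal C$, let $\mathcal A\otimes^{\min}\mathcal D$ denote the closure of $\mathcal A\otimes\mathcal D$ in $\mathcal C\otimes^{\min}\mathcal D$. For $*$-subalgebras $\mathcal A,\mathcal B$ of a $C^*$-algebra, with closed unit balls $B_1(\mathcal A),B_1(\mathcal B)$, let $$d_{KK}(\mathcal A,\mathcal B)=\max\Big\{\sup_{x\in B_1(\mathcal A)}\inf_{y\in B_1(\mathcal B)}\|x-y\|,\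 \sup_{y\in B_1(\mathcal B)}\inf_{x\in B_1(\mathcal A)}\|x-y\|\Big\}$$ be the Kadison--Kastler distance, and let the Christensen distance $d_0(\mathcal A,\mathcal B)$ be the infimum of all $\gamma>0$ such that for every $x\in B_1(\mathcal A)$ there is $y\in\mathcal B$ with $\|x-y\|\le\gamma$, and for every $y\in B_1(\mathcal B)$ there is $x\in\mathcal A$ with $\|x-y\|\le\gamma$. Then, for any two finite-dimensional $*$-subalgebras $\mathcal A$ and $\mathcal B$ of $\mathcal C$, $$d_{KK}(\mathcal A,\mathcal B)\le d_{KK}(\mathcal A\otimes^{\min}\mathcal D,\ \mathcal B\otimes^{\min}\mathcal D)\quad\text{and}\quad d_0(\mathcal A,\mathcal B)\le d_0(\mathcal A\otimes^{\min}\mathcal D,\ \mathcal B\otimes^{\min}\mathcal D),$$ where the distances on the left are taken in $\mathcal C$ and those on the right in $\mathcal C\otimes^{\min}\mathcal D$. -/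

import Mathlib

open scoped TensorProduct ComplexOrder InnerProductSpace

noncomputable section

namespace CStarDist

universe u v

/-! ### States -/

/-- A state of a (possibly non-unital) C⋆-algebra: a positive linear functional of norm one. -/
structure IsState {C : Type u} [NonUnitalCStarAlgebra C] (φ : C →L[ℂ] ℂ) : Prop where
  nonneg : ∀ x : C, 0 ≤ φ (star x * x)
  norm_eq_one : ‖φ‖ = 1

/-! ### The algebraic tensor product as a ⋆-algebra -/

/-- The algebraic tensor product `C ⊗ D` over `ℂ`. It is given its own name because it carries the
minimal C⋆-norm below. -/
def AlgTensor (C : Type u) (D : Type v) [NonUnitalCStarAlgebra C] [NonUnitalCStarAlgebra D] :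
    Type (max u v) :=
  C ⊗[ℂ] D

section Alg

variable {C : Type u} {D : Type v} [NonUnitalCStarAlgebra C] [NonUnitalCStarAlgebra D]

instance : NonUnitalRing (AlgTensor C D) := inferInstanceAs (NonUnitalRing (C ⊗[ℂ] D))
instance : Module ℂ (AlgTensor C D) := inferInstanceAs (Module ℂ (C ⊗[ℂ] D))
instance : IsScalarTower ℂ (AlgTensor C D) (AlgTensor C D) :=
  inferInstanceAs (IsScalarTower ℂ (C ⊗[ℂ] D) (C ⊗[ℂ] D))
instance : SMulCommClass ℂ (AlgTensor C D) (AlgTensor C D) :=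
  inferInstanceAs (SMulCommClass ℂ (C ⊗[ℂ] D) (C ⊗[ℂ] D))
instance : StarAddMonoid (AlgTensor C D) := inferInstanceAs (StarAddMonoid (C ⊗[ℂ] D))
instance : StarModule ℂ (AlgTensor C D) := inferInstanceAs (StarModule ℂ (C ⊗[ℂ] D))

/-- The elementary tensor `c ⊗ d`. -/
def tmul (c : C) (d : D) : AlgTensor C D := c ⊗ₜ[ℂ] d

theorem tmul_mul_tmul (c c' : C) (d d' : D) :
    tmul c d * tmul c' d' = tmul (c * c') (d * d') :=
  Algebra.TensorProduct.tmul_mul_tmul c c' d d'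

theorem star_tmul (c : C) (d : D) : star (tmul c d) = tmul (star c) (star d) := rfl

theorem alg_induction {p : AlgTensor C D → Prop} (z : AlgTensor C D) (h0 : p 0)
    (ht : ∀ c d, p (tmul c d)) (ha : ∀ x y, p x → p y → p (x + y)) : p z :=
  TensorProduct.induction_on (motive := p) z h0 ht ha

instance : StarRing (AlgTensor C D) where
  star_add := star_add
  star_mul x y := by
    induction x using alg_induction with
    | h0 => simp
    | ha x x' hx hx' => rw [add_mul, star_add, hx, hx', star_add, mul_add]
    | ht c d =>
      induction y using alg_induction with
      | h0 => simp
      | ha y y' hy hy' => rw [mul_add, star_add, hy, hy', star_add, add_mul]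
      | ht c' d' => simp only [tmul_mul_tmul, star_tmul, star_mul]

/-- The product functional `φ ⊗ ψ` on `C ⊗ D`, determined by
`(φ ⊗ ψ) (c ⊗ d) = φ c * ψ d`. -/
def prodFunctional (φ : C →L[ℂ] ℂ) (ψ : D →L[ℂ] ℂ) : AlgTensor C D →ₗ[ℂ] ℂ :=
  LinearMap.mul' ℂ ℂ ∘ₗ TensorProduct.map φ.toLinearMap ψ.toLinearMap

@[simp] theorem prodFunctional_tmul (φ : C →L[ℂ] ℂ) (ψ : D →L[ℂ] ℂ) (c : C) (d : D) :
    prodFunctional φ ψ (tmul c d) = φ c * ψ d := by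
  change LinearMap.mul' ℂ ℂ (TensorProduct.map φ.toLinearMap ψ.toLinearMap (c ⊗ₜ[ℂ] d)) = _
  simp

/-! ### The minimal C⋆-norm -/

/-- The set of all quotients
`((φ ⊗ ψ) (w⋆ z⋆ z w)) ^ (1/2) / ((φ ⊗ ψ) (w⋆ w)) ^ (1/2)`, where `φ`, `ψ` run over the states of
`C` and `D` and `w` over the elements of `C ⊗ D` with `(φ ⊗ ψ) (w⋆ w) ≠ 0`. (All the numbers
`(φ ⊗ ψ) (x⋆ x)` are real and non-negative.) -/
def minNormSet (z : AlgTensor C D) : Set ℝ :=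
  {r | ∃ (φ : C →L[ℂ] ℂ) (ψ : D →L[ℂ] ℂ) (w : AlgTensor C D), IsState φ ∧ IsState ψ ∧
    prodFunctional φ ψ (star w * w) ≠ 0 ∧
    r = √ (prodFunctional φ ψ (star w * star z * z * w)).re /
      √ (prodFunctional φ ψ (star w * w)).re}

/-- The minimal C⋆-norm on the algebraic tensor product `C ⊗ D`. -/
def minNorm (z : AlgTensor C D) : ℝ := sSup (minNormSet z)

/-- Existence of the Gelfand-Naimark-Segal representation of a state, in the form needed here. -/
theorem exists_gns {φ : C →L[ℂ] ℂ} (hφ : IsState φ) :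
    ∃ (H : Type u) (_ : NormedAddCommGroup H) (_ : InnerProductSpace ℂ H) (V : C →ₗ[ℂ] H)
      (T : C → H →L[ℂ] H), (∀ x y, ⟪V x, V y⟫_ℂ = φ (star x * y)) ∧
      (∀ c x, T c (V x) = V (c * x)) ∧ ∀ c, ‖T c‖ ≤ ‖c‖ := by
  let _ := CStarAlgebra.spectralOrder C
  have _ := CStarAlgebra.spectralOrderedRing C
  let f : C →ₚ[ℂ] ℂ := PositiveLinearMap.mk₀ φ.toLinearMap (by
    intro x hx
    obtain ⟨y, rfl⟩ := CStarAlgebra.nonneg_iff_eq_star_mul_self.mp hx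
    exact hφ.nonneg y)
  refine ⟨f.GNS, inferInstance, inferInstance,
    (UniformSpace.Completion.toComplₗᵢ (𝕜 := ℂ) (E := f.PreGNS)).toLinearMap ∘ₗ
      f.toPreGNS.toLinearMap, fun c => f.gnsNonUnitalStarAlgHom c, ?_, ?_, ?_⟩
  · intro x y
    change ⟪((f.toPreGNS x : f.PreGNS) : f.GNS), ((f.toPreGNS y : f.PreGNS) : f.GNS)⟫_ℂ = _
    rw [UniformSpace.Completion.inner_coe, PositiveLinearMap.preGNS_inner_def]
    rfl
  · intro c x
    change f.gnsNonUnitalStarAlgHom c ((f.toPreGNS x : f.PreGNS) : f.GNS) = _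
    rw [PositiveLinearMap.gnsNonUnitalStarAlgHom_apply_coe]
    rfl
  · intro c
    exact NonUnitalStarAlgHom.norm_apply_le f.gnsNonUnitalStarAlgHom c

/-- The pre-Hilbert space attached to a product of two states. -/
theorem exists_gns_prod {φ : C →L[ℂ] ℂ} {ψ : D →L[ℂ] ℂ} (hφ : IsState φ) (hψ : IsState ψ) :
    ∃ (H : Type (max u v)) (_ : NormedAddCommGroup H) (_ : InnerProductSpace ℂ H)
      (V : AlgTensor C D →ₗ[ℂ] H),
      (∀ x y, ⟪V x, V y⟫_ℂ = prodFunctional φ ψ (star x * y)) ∧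
      ∀ c d w, ‖V (tmul c d * w)‖ ≤ ‖c‖ * ‖d‖ * ‖V w‖ := by
  obtain ⟨H, _, _, V, T, hV, hT, hTn⟩ := exists_gns hφ
  obtain ⟨K, _, _, W, S, hW, hS, hSn⟩ := exists_gns hψ
  let VW : AlgTensor C D →ₗ[ℂ] H ⊗[ℂ] K := TensorProduct.map V W
  have hVW : ∀ c d, VW (tmul c d) = V c ⊗ₜ[ℂ] W d := fun c d => rfl
  refine ⟨H ⊗[ℂ] K, inferInstance, inferInstance, VW, ?_, ?_⟩
  · intro x y
    induction x using alg_induction with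
    | h0 => simp
    | ha x x' hx hx' => rw [map_add, inner_add_left, hx, hx', star_add, add_mul, map_add]
    | ht c d =>
      induction y using alg_induction with
      | h0 => simp
      | ha y y' hy hy' => rw [map_add, inner_add_right, hy, hy', mul_add, map_add]
      | ht c' d' =>
        rw [hVW, hVW, TensorProduct.inner_tmul, hV, hW, star_tmul, tmul_mul_tmul,
          prodFunctional_tmul]
  · intro c d w
    have key : VW (tmul c d * w) = TensorProduct.mapL (T c) (S d) (VW w) := by
      induction w using alg_induction with
      | h0 => simp
      | ha y y' hy hy' => rw [mul_add, map_add, hy, hy', map_add, map_add]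
      | ht c' d' =>
        rw [tmul_mul_tmul, hVW, hVW, TensorProduct.mapL_tmul, hT, hS]
    rw [key]
    refine (ContinuousLinearMap.le_opNorm _ _).trans ?_
    gcongr
    refine (TensorProduct.norm_mapL_le _ _).trans ?_
    gcongr
    · exact hTn c
    · exact hSn d

/-- The seminorm `x ↦ ((φ ⊗ ψ) (x⋆ x)) ^ (1/2)` on `C ⊗ D`. -/
def stateNorm (φ : C →L[ℂ] ℂ) (ψ : D →L[ℂ] ℂ) (x : AlgTensor C D) : ℝ :=
  √ (prodFunctional φ ψ (star x * x)).re

theorem stateNorm_nonneg (φ : C →L[ℂ] ℂ) (ψ : D →L[ℂ] ℂ) (x : AlgTensor C D) :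
    0 ≤ stateNorm φ ψ x := Real.sqrt_nonneg _

theorem exists_bound (z : AlgTensor C D) :
    ∃ M : ℝ, 0 ≤ M ∧ ∀ (φ : C →L[ℂ] ℂ) (ψ : D →L[ℂ] ℂ), IsState φ → IsState ψ →
      ∀ w, stateNorm φ ψ (z * w) ≤ M * stateNorm φ ψ w := by
  have hn : ∀ {H : Type (max u v)} [NormedAddCommGroup H] [InnerProductSpace ℂ H]
      (V : AlgTensor C D →ₗ[ℂ] H) (φ : C →L[ℂ] ℂ) (ψ : D →L[ℂ] ℂ),
      (∀ x y, ⟪V x, V y⟫_ℂ = prodFunctional φ ψ (star x * y)) →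
      ∀ x, stateNorm φ ψ x = ‖V x‖ := by
    intro H _ _ V φ ψ h x
    rw [stateNorm, ← h, norm_eq_sqrt_re_inner (𝕜 := ℂ)]
    rfl
  induction z using alg_induction with
  | h0 => exact ⟨0, le_rfl, fun φ ψ _ _ w => by simp [stateNorm]⟩
  | ht c d =>
    refine ⟨‖c‖ * ‖d‖, by positivity, fun φ ψ hφ hψ w => ?_⟩
    obtain ⟨H, _, _, V, hV, hb⟩ := exists_gns_prod hφ hψ
    rw [hn V φ ψ hV, hn V φ ψ hV]
    exact hb c d w
  | ha x y hx hy =>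
    obtain ⟨M, hM, hx⟩ := hx
    obtain ⟨N, hN, hy⟩ := hy
    refine ⟨M + N, by positivity, fun φ ψ hφ hψ w => ?_⟩
    have h1 := hx φ ψ hφ hψ w
    have h2 := hy φ ψ hφ hψ w
    obtain ⟨H, _, _, V, hV, -⟩ := exists_gns_prod hφ hψ
    simp only [hn V φ ψ hV] at h1 h2 ⊢
    rw [add_mul, map_add, add_mul]
    exact (norm_add_le _ _).trans (add_le_add h1 h2)

theorem stateNorm_props {φ : C →L[ℂ] ℂ} {ψ : D →L[ℂ] ℂ} (hφ : IsState φ) (hψ : IsState ψ) :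
    (∀ x y, stateNorm φ ψ (x + y) ≤ stateNorm φ ψ x + stateNorm φ ψ y) ∧
    (∀ (a : ℂ) x, stateNorm φ ψ (a • x) = ‖a‖ * stateNorm φ ψ x) ∧
    (∀ x y, ‖prodFunctional φ ψ (star x * y)‖ ≤ stateNorm φ ψ x * stateNorm φ ψ y) ∧
    (∀ x, prodFunctional φ ψ (star x * x) = ((stateNorm φ ψ x ^ 2 : ℝ) : ℂ)) := by
  obtain ⟨H, _, _, V, hV, -⟩ := exists_gns_prod hφ hψ
  have hn : ∀ x, stateNorm φ ψ x = ‖V x‖ := by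
    intro x
    rw [stateNorm, ← hV, norm_eq_sqrt_re_inner (𝕜 := ℂ)]
    rfl
  simp only [hn, ← hV, map_add, map_smul, norm_smul]
  refine ⟨fun x y => norm_add_le _ _, fun _ _ => trivial, fun x y => norm_inner_le_norm _ _,
    fun x => ?_⟩
  rw [inner_self_eq_norm_sq_to_K]
  norm_cast

theorem mem_minNormSet {z : AlgTensor C D} {r : ℝ} :
    r ∈ minNormSet z ↔ ∃ (φ : C →L[ℂ] ℂ) (ψ : D →L[ℂ] ℂ) (w : AlgTensor C D),
      IsState φ ∧ IsState ψ ∧ stateNorm φ ψ w ≠ 0 ∧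
      r = stateNorm φ ψ (z * w) / stateNorm φ ψ w := by
  constructor
  · rintro ⟨φ, ψ, w, hφ, hψ, hw, rfl⟩
    refine ⟨φ, ψ, w, hφ, hψ, ?_, by simp [stateNorm, mul_assoc]⟩
    rintro h
    rw [(stateNorm_props hφ hψ).2.2.2, h] at hw
    simp at hw
  · rintro ⟨φ, ψ, w, hφ, hψ, hw, rfl⟩
    refine ⟨φ, ψ, w, hφ, hψ, ?_, by simp [stateNorm, mul_assoc]⟩
    rw [(stateNorm_props hφ hψ).2.2.2]
    exact_mod_cast pow_ne_zero 2 hw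

theorem minNorm_nonneg (z : AlgTensor C D) : 0 ≤ minNorm z := by
  refine Real.sSup_nonneg fun r hr => ?_
  obtain ⟨φ, ψ, w, -, -, -, rfl⟩ := mem_minNormSet.mp hr
  exact div_nonneg (stateNorm_nonneg _ _ _) (stateNorm_nonneg _ _ _)

theorem bddAbove_minNormSet (z : AlgTensor C D) : BddAbove (minNormSet z) := by
  obtain ⟨M, hM, h⟩ := exists_bound z
  refine ⟨M, fun r hr => ?_⟩
  obtain ⟨φ, ψ, w, hφ, hψ, hw, rfl⟩ := mem_minNormSet.mp hr
  exact div_le_of_le_mul₀ (stateNorm_nonneg _ _ _) hM (h φ ψ hφ hψ w)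

theorem stateNorm_mul_le {φ : C →L[ℂ] ℂ} {ψ : D →L[ℂ] ℂ} (hφ : IsState φ) (hψ : IsState ψ)
    (z w : AlgTensor C D) : stateNorm φ ψ (z * w) ≤ minNorm z * stateNorm φ ψ w := by
  by_cases hw : stateNorm φ ψ w = 0
  · obtain ⟨M, hM, h⟩ := exists_bound z
    simpa [hw] using h φ ψ hφ hψ w
  · have hpos : 0 < stateNorm φ ψ w := lt_of_le_of_ne (stateNorm_nonneg _ _ _) (Ne.symm hw)
    rw [← div_le_iff₀ hpos]
    exact le_csSup (bddAbove_minNormSet z) (mem_minNormSet.mpr ⟨φ, ψ, w, hφ, hψ, hw, rfl⟩)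

theorem minNorm_le {z : AlgTensor C D} {M : ℝ} (hM : 0 ≤ M)
    (h : ∀ (φ : C →L[ℂ] ℂ) (ψ : D →L[ℂ] ℂ), IsState φ → IsState ψ →
      ∀ w, stateNorm φ ψ (z * w) ≤ M * stateNorm φ ψ w) : minNorm z ≤ M := by
  refine Real.sSup_le (fun r hr => ?_) hM
  obtain ⟨φ, ψ, w, hφ, hψ, hw, rfl⟩ := mem_minNormSet.mp hr
  exact div_le_of_le_mul₀ (stateNorm_nonneg _ _ _) hM (h φ ψ hφ hψ w)

theorem minNorm_add_le (x y : AlgTensor C D) : minNorm (x + y) ≤ minNorm x + minNorm y := by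
  refine minNorm_le (add_nonneg (minNorm_nonneg x) (minNorm_nonneg y)) fun φ ψ hφ hψ w => ?_
  rw [add_mul, add_mul]
  exact ((stateNorm_props hφ hψ).1 _ _).trans
    (add_le_add (stateNorm_mul_le hφ hψ x w) (stateNorm_mul_le hφ hψ y w))

theorem minNorm_smul_le (a : ℂ) (x : AlgTensor C D) : minNorm (a • x) ≤ ‖a‖ * minNorm x := by
  refine minNorm_le (mul_nonneg (norm_nonneg a) (minNorm_nonneg x)) fun φ ψ hφ hψ w => ?_
  rw [smul_mul_assoc, (stateNorm_props hφ hψ).2.1, mul_assoc]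
  exact mul_le_mul_of_nonneg_left (stateNorm_mul_le hφ hψ x w) (norm_nonneg a)

theorem minNorm_zero : minNorm (0 : AlgTensor C D) = 0 :=
  le_antisymm (minNorm_le le_rfl fun φ ψ _ _ w => by simp [stateNorm]) (minNorm_nonneg _)

theorem minNorm_neg (x : AlgTensor C D) : minNorm (-x) = minNorm x := by
  have h : ∀ y : AlgTensor C D, minNorm (-y) ≤ minNorm y := fun y => by
    simpa using minNorm_smul_le (-1) y
  exact le_antisymm (h x) (by simpa using h (-x))

theorem minNorm_mul_le (x y : AlgTensor C D) : minNorm (x * y) ≤ minNorm x * minNorm y := by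
  refine minNorm_le (mul_nonneg (minNorm_nonneg x) (minNorm_nonneg y)) fun φ ψ hφ hψ w => ?_
  rw [mul_assoc, mul_assoc]
  exact (stateNorm_mul_le hφ hψ x _).trans
    (mul_le_mul_of_nonneg_left (stateNorm_mul_le hφ hψ y w) (minNorm_nonneg x))

theorem minNorm_mul_self_le (x : AlgTensor C D) :
    minNorm x * minNorm x ≤ minNorm (star x * x) := by
  have h : minNorm x ≤ √ (minNorm (star x * x)) := by
    refine minNorm_le (Real.sqrt_nonneg _) fun φ ψ hφ hψ w => ?_
    obtain ⟨-, -, hcs, hsq⟩ := stateNorm_props hφ hψ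
    have h1 : stateNorm φ ψ (x * w) ^ 2 ≤ minNorm (star x * x) * stateNorm φ ψ w ^ 2 := by
      have h2 := hcs w (star x * x * w)
      have h3 := hsq (x * w)
      rw [star_mul, show star w * star x * (x * w) = star w * (star x * x * w) by
        simp only [mul_assoc]] at h3
      rw [h3, Complex.norm_real, Real.norm_of_nonneg (sq_nonneg _)] at h2
      nlinarith [mul_le_mul_of_nonneg_left (stateNorm_mul_le hφ hψ (star x * x) w)
        (stateNorm_nonneg φ ψ w)]
    rw [← Real.sqrt_sq (stateNorm_nonneg φ ψ w), ← Real.sqrt_mul (minNorm_nonneg _)]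
    exact Real.le_sqrt_of_sq_le h1
  have := mul_self_le_mul_self (minNorm_nonneg x) h
  rwa [Real.mul_self_sqrt (minNorm_nonneg _)] at this

/-- The algebraic tensor product with the minimal norm. -/
instance : NonUnitalSeminormedRing (AlgTensor C D) where
  __ := (inferInstance : NonUnitalRing (AlgTensor C D))
  __ := AddGroupSeminorm.toSeminormedAddCommGroup (E := AlgTensor C D)
    { toFun := minNorm
      map_zero' := minNorm_zero
      add_le' := minNorm_add_le
      neg' := minNorm_neg }
  norm_mul_le := minNorm_mul_le

theorem norm_def (x : AlgTensor C D) : ‖x‖ = minNorm x := rfl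

instance : NormedSpace ℂ (AlgTensor C D) where
  norm_smul_le := minNorm_smul_le

theorem norm_star_alg (x : AlgTensor C D) : ‖star x‖ = ‖x‖ := by
  have h : ∀ y : AlgTensor C D, ‖y‖ ≤ ‖star y‖ := fun y => by
    by_contra! hlt
    have h1 := (minNorm_mul_self_le y).trans (minNorm_mul_le (star y) y)
    change ‖y‖ * ‖y‖ ≤ ‖star y‖ * ‖y‖ at h1
    have hy : 0 < ‖y‖ := (norm_nonneg _).trans_lt hlt
    exact absurd (le_of_mul_le_mul_right h1 hy) (not_le.mpr hlt)
  exact le_antisymm (by simpa using h (star x)) (h x)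

end Alg

/-! ### The minimal tensor product -/

/-- The minimal tensor product of two C⋆-algebras: the completion of the algebraic tensor product
with respect to the minimal C⋆-norm. -/
def MinTensor (C : Type u) (D : Type v) [NonUnitalCStarAlgebra C] [NonUnitalCStarAlgebra D] :
    Type (max u v) :=
  UniformSpace.Completion (AlgTensor C D)

section Min

open UniformSpace

variable {C : Type u} {D : Type v} [NonUnitalCStarAlgebra C] [NonUnitalCStarAlgebra D]

instance : NormedAddCommGroup (MinTensor C D) :=
  inferInstanceAs (NormedAddCommGroup (Completion (AlgTensor C D)))
instance : NormedSpace ℂ (MinTensor C D) :=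
  inferInstanceAs (NormedSpace ℂ (Completion (AlgTensor C D)))
instance : CompleteSpace (MinTensor C D) :=
  inferInstanceAs (CompleteSpace (Completion (AlgTensor C D)))

/-- The canonical map from the algebraic tensor product to its completion. -/
def ofAlg : AlgTensor C D →ₗᵢ[ℂ] MinTensor C D := Completion.toComplₗᵢ

theorem denseRange_ofAlg : DenseRange (ofAlg : AlgTensor C D → MinTensor C D) :=
  Completion.denseRange_coe

theorem isDenseInducing_ofAlg : IsDenseInducing (ofAlg : AlgTensor C D → MinTensor C D) :=
  Completion.isDenseInducing_coe

theorem continuous_ofAlg : Continuous (ofAlg : AlgTensor C D → MinTensor C D) :=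
  ofAlg.continuous

/-- Multiplication on the completion: the continuous extension of multiplication on `C ⊗ D`. -/
instance : Mul (MinTensor C D) :=
  ⟨Function.curry <| (isDenseInducing_ofAlg.prodMap isDenseInducing_ofAlg).extend
    (ofAlg ∘ Function.uncurry (· * ·))⟩

/-- The involution on the completion: the continuous extension of the involution on `C ⊗ D`. -/
instance : Star (MinTensor C D) :=
  ⟨Completion.map (star : AlgTensor C D → AlgTensor C D)⟩

theorem ofAlg_mul (x y : AlgTensor C D) : ofAlg (x * y) = ofAlg x * ofAlg y :=
  ((isDenseInducing_ofAlg.prodMap isDenseInducing_ofAlg).extend_eq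
    (continuous_ofAlg.comp continuous_mul) (x, y)).symm

theorem uniformContinuous_star_alg :
    UniformContinuous (star : AlgTensor C D → AlgTensor C D) :=
  (AddMonoidHomClass.isometry_of_norm (starAddEquiv : AlgTensor C D ≃+ AlgTensor C D)
    norm_star_alg).uniformContinuous

theorem ofAlg_star (x : AlgTensor C D) : ofAlg (star x) = star (ofAlg x) :=
  (Completion.map_coe uniformContinuous_star_alg x).symm

instance : ContinuousMul (MinTensor C D) where
  continuous_mul := by
    let j : AlgTensor C D →+ MinTensor C D := (ofAlg (C := C) (D := D)).toLinearMap.toAddMonoidHom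
    let m := (AddMonoidHom.mul : AlgTensor C D →+ AlgTensor C D →+ AlgTensor C D).compr₂ j
    have : Continuous fun p : AlgTensor C D × AlgTensor C D => m p.1 p.2 :=
      continuous_ofAlg.comp continuous_mul
    have di : IsDenseInducing (j : AlgTensor C D → MinTensor C D) := isDenseInducing_ofAlg
    exact (di.extend_Z_bilin di this :)

instance : ContinuousStar (MinTensor C D) where
  continuous_star := Completion.continuous_map (f := (star : AlgTensor C D → AlgTensor C D))

theorem min_induction {p : MinTensor C D → Prop} (x : MinTensor C D) (hp : IsClosed {x | p x})
    (h : ∀ a, p (ofAlg a)) : p x := Completion.induction_on x hp h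

theorem min_induction₂ {p : MinTensor C D → MinTensor C D → Prop} (x y : MinTensor C D)
    (hp : IsClosed {x : MinTensor C D × MinTensor C D | p x.1 x.2})
    (h : ∀ a b, p (ofAlg a) (ofAlg b)) : p x y := Completion.induction_on₂ x y hp h

theorem min_induction₃ {p : MinTensor C D → MinTensor C D → MinTensor C D → Prop}
    (x y z : MinTensor C D)
    (hp : IsClosed {x : MinTensor C D × MinTensor C D × MinTensor C D | p x.1 x.2.1 x.2.2})
    (h : ∀ a b c, p (ofAlg a) (ofAlg b) (ofAlg c)) : p x y z :=
  Completion.induction_on₃ x y z hp h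

instance : NonUnitalRing (MinTensor C D) where
  __ := (inferInstance : AddCommGroup (MinTensor C D))
  __ := (inferInstance : Mul (MinTensor C D))
  zero_mul x := by
    induction x using min_induction with
    | hp => exact isClosed_eq (by fun_prop) (by fun_prop)
    | h a => rw [← map_zero ofAlg, ← ofAlg_mul, zero_mul]
  mul_zero x := by
    induction x using min_induction with
    | hp => exact isClosed_eq (by fun_prop) (by fun_prop)
    | h a => rw [← map_zero ofAlg, ← ofAlg_mul, mul_zero]
  mul_assoc x y z := by
    induction x, y, z using min_induction₃ with
    | hp => exact isClosed_eq (by fun_prop) (by fun_prop)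
    | h a b c => simp only [← ofAlg_mul, mul_assoc]
  left_distrib x y z := by
    induction x, y, z using min_induction₃ with
    | hp => exact isClosed_eq (by fun_prop) (by fun_prop)
    | h a b c => simp only [← ofAlg_mul, ← map_add, mul_add]
  right_distrib x y z := by
    induction x, y, z using min_induction₃ with
    | hp => exact isClosed_eq (by fun_prop) (by fun_prop)
    | h a b c => simp only [← ofAlg_mul, ← map_add, add_mul]

instance : StarRing (MinTensor C D) where
  __ := (inferInstance : Star (MinTensor C D))
  star_involutive x := by
    induction x using min_induction with
    | hp => exact isClosed_eq (by fun_prop) (by fun_prop)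
    | h a => simp only [← ofAlg_star, star_star]
  star_mul x y := by
    induction x, y using min_induction₂ with
    | hp => exact isClosed_eq (by fun_prop) (by fun_prop)
    | h a b => simp only [← ofAlg_star, ← ofAlg_mul, star_mul]
  star_add x y := by
    induction x, y using min_induction₂ with
    | hp => exact isClosed_eq (by fun_prop) (by fun_prop)
    | h a b => simp only [← ofAlg_star, ← map_add, star_add]

instance : IsScalarTower ℂ (MinTensor C D) (MinTensor C D) where
  smul_assoc r x y := by
    change (r • x) * y = r • (x * y)
    induction x, y using min_induction₂ with
    | hp =>
      exact isClosed_eq ((continuous_fst.const_smul r).mul continuous_snd)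
        ((continuous_fst.mul continuous_snd).const_smul r)
    | h a b => simp only [← ofAlg_mul, ← map_smul, smul_mul_assoc]

instance : SMulCommClass ℂ (MinTensor C D) (MinTensor C D) where
  smul_comm r x y := by
    change r • (x * y) = x * (r • y)
    induction x, y using min_induction₂ with
    | hp =>
      exact isClosed_eq ((continuous_fst.mul continuous_snd).const_smul r)
        (continuous_fst.mul (continuous_snd.const_smul r))
    | h a b => simp only [← ofAlg_mul, ← map_smul, mul_smul_comm]

instance : StarModule ℂ (MinTensor C D) where
  star_smul r x := by
    induction x using min_induction with
    | hp => exact isClosed_eq (continuous_id.const_smul r).star (continuous_star.const_smul (star r))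
    | h a => simp only [← ofAlg_star, ← map_smul, star_smul]

instance : NonUnitalNormedRing (MinTensor C D) where
  __ := (inferInstance : NormedAddCommGroup (MinTensor C D))
  __ := (inferInstance : NonUnitalRing (MinTensor C D))
  norm_mul_le x y := by
    induction x, y using min_induction₂ with
    | hp => exact isClosed_le (by fun_prop) (by fun_prop)
    | h a b => simpa only [← ofAlg_mul, ofAlg.norm_map] using norm_mul_le a b

instance : CStarRing (MinTensor C D) where
  norm_mul_self_le x := by
    induction x using min_induction with
    | hp => exact isClosed_le (by fun_prop) (by fun_prop)
    | h a =>
      rw [← ofAlg_star, ← ofAlg_mul, ofAlg.norm_map, ofAlg.norm_map]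
      exact minNorm_mul_self_le a

/-- The minimal tensor product is a C⋆-algebra. -/
instance : NonUnitalCStarAlgebra (MinTensor C D) where

/-- `A ⊗min D`, as a C⋆-subalgebra of `C ⊗min D`: the closure of the image of the algebraic tensor
product `A ⊗ D`, that is, of the linear span of the elementary tensors `a ⊗ d` with `a ∈ A`. -/
def minTensorSub (A : NonUnitalStarSubalgebra ℂ C) (D : Type v) [NonUnitalCStarAlgebra D] :
    NonUnitalStarSubalgebra ℂ (MinTensor C D) :=
  NonUnitalStarSubalgebra.topologicalClosure
    { Submodule.span ℂ {x : MinTensor C D | ∃ a ∈ A, ∃ d : D, x = ofAlg (tmul a d)} with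
      mul_mem' := by
        intro x y hx hy
        induction hx, hy using Submodule.span_induction₂ with
        | mem_mem x y hx hy =>
          obtain ⟨a, ha, d, rfl⟩ := hx
          obtain ⟨b, hb, e, rfl⟩ := hy
          rw [← ofAlg_mul, tmul_mul_tmul]
          exact Submodule.subset_span ⟨a * b, mul_mem ha hb, d * e, rfl⟩
        | zero_left y hy => rw [zero_mul]; exact Submodule.zero_mem _
        | zero_right x hx => rw [mul_zero]; exact Submodule.zero_mem _
        | add_left x y z _ _ _ h1 h2 => rw [add_mul]; exact Submodule.add_mem _ h1 h2
        | add_right x y z _ _ _ h1 h2 => rw [mul_add]; exact Submodule.add_mem _ h1 h2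
        | smul_left r x y _ _ h => rw [smul_mul_assoc]; exact Submodule.smul_mem _ r h
        | smul_right r x y _ _ h => rw [mul_smul_comm]; exact Submodule.smul_mem _ r h
      star_mem' := by
        intro x hx
        induction hx using Submodule.span_induction with
        | mem x hx =>
          obtain ⟨a, ha, d, rfl⟩ := hx
          rw [← ofAlg_star, star_tmul]
          exact Submodule.subset_span ⟨star a, star_mem ha, star d, rfl⟩
        | zero => rw [star_zero]; exact Submodule.zero_mem _
        | add x y _ _ h1 h2 => rw [star_add]; exact Submodule.add_mem _ h1 h2
        | smul r x _ h => rw [star_smul]; exact Submodule.smul_mem _ _ h }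

end Min

/-! ### The two distances -/

section Dist

variable {C : Type u} [NonUnitalCStarAlgebra C]

/-- The closed unit ball of a subalgebra. -/
def unitBall (A : NonUnitalStarSubalgebra ℂ C) : Set C := {x | x ∈ A ∧ ‖x‖ ≤ 1}

/-- The Kadison-Kastler distance: the Hausdorff distance between the closed unit balls. -/
def dKK (A B : NonUnitalStarSubalgebra ℂ C) : ℝ :=
  Metric.hausdorffDist (unitBall A) (unitBall B)

/-- The near inclusion `A ⊆_γ B`: every element of the closed unit ball of `A` is within `γ` of
some element of `B`. -/
def NearInclusion (A B : NonUnitalStarSubalgebra ℂ C) (γ : ℝ) : Prop :=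
  ∀ x ∈ unitBall A, ∃ y ∈ B, ‖x - y‖ ≤ γ

/-- The Christensen distance. -/
def d₀ (A B : NonUnitalStarSubalgebra ℂ C) : ℝ :=
  sInf {γ : ℝ | 0 < γ ∧ NearInclusion A B γ ∧ NearInclusion B A γ}

end Dist

end CStarDist

end

open scoped CStarAlgebra

noncomputable section

namespace CStarDist

universe u v

/-! ### Existence of states -/

/-! The proof rests on a contractive left inverse of an isometric-type embedding `c ↦ c ⊗ h`. Take
`d` in `D` of norm one, put `h = d⋆d`, and choose a state `ψ` with `ψ (h³) = 1`. The slice map `c ⊗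
x ↦ ψ (h x h) c` is contractive for the minimal norm, extends to `S` on the completion, and
satisfies `S (c ⊗ h) = c` (`exists_slice`). If `x` is in the unit ball of `A`, then `x ⊗ h` is in
the unit ball of `A ⊗min D`; if `z` in `B ⊗min D` approximates it, then `S z` approximates `x` at
least as well. Since `B` is finite-dimensional, hence closed, `S z` lies in `B`
(`map_mem_of_mem_minTensorSub`), and in the unit ball if `z` does. Both inequalities follow.

Contractivity of the slice (`norm_algSlice_le`) needs enough states on `C`. They come from
Hahn-Banach in the unitization. Without a unit there is no obvious cyclic vector, so vectors of the
form `w ⊗ h` replace it; this is why cubes `(a⋆a)³` are normed. -/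

theorem norm_one_add_of_nonneg {U : Type*} [CStarAlgebra U] [PartialOrder U] [StarOrderedRing U]
    [Nontrivial U] {b : U} (hb : 0 ≤ b) : ‖1 + b‖ = 1 + ‖b‖ := by
  refine le_antisymm ((norm_add_le _ _).trans (by simp)) ?_
  -- The norm of a positive element is a point of its spectrum, and adding the unit translates the
  -- spectrum by one.
  have h : (‖b‖ + 1 : ℝ) ∈ spectrum ℝ (algebraMap ℝ U 1 + b) :=
    spectrum.add_mem_add_iff.mpr (CStarAlgebra.norm_mem_spectrum_of_nonneg hb)
  have h2 := spectrum.norm_le_norm_of_mem h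
  rw [map_one, Real.norm_of_nonneg (by positivity), add_comm ‖b‖] at h2
  exact h2

/-- Imaginary shifts `p + it` force `g p` to be real, and the bound `‖‖p‖ - p‖ ≤ ‖p‖` then forces it
to be non-negative. -/
theorem nonneg_apply_of_unital_contractive {U : Type*} [CStarAlgebra U] [PartialOrder U]
    [StarOrderedRing U] {g : U →L[ℂ] ℂ} (hg : ‖g‖ ≤ 1) (h1 : g 1 = 1) {p : U} (hp : 0 ≤ p) :
    0 ≤ g p := by
  have hle : ∀ x, ‖g x‖ ≤ ‖x‖ := fun x => by
    simpa using g.le_of_opNorm_le hg x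
  have hsa : star p = p := (IsSelfAdjoint.of_nonneg hp).star_eq
  have him : (g p).im = 0 := by
    have key : ∀ t : ℝ, ((g p).im + t) ^ 2 ≤ ‖p‖ ^ 2 + t ^ 2 := by
      intro t
      have e1 : g (p + ((t : ℂ) * Complex.I) • (1 : U)) = g p + t * Complex.I := by
        simp [h1]
      have e2 : ‖p + ((t : ℂ) * Complex.I) • (1 : U)‖ ^ 2 ≤ ‖p‖ ^ 2 + t ^ 2 := by
        rw [sq, ← CStarRing.norm_star_mul_self]
        have e3 : star (p + ((t : ℂ) * Complex.I) • (1 : U)) * (p + ((t : ℂ) * Complex.I) • (1 : U))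
            = p * p + ((t : ℂ) ^ 2) • (1 : U) := by
          rw [star_add, star_smul, star_one, hsa, add_mul, mul_add, mul_add]
          simp only [mul_smul_comm, smul_mul_assoc, mul_one, one_mul, smul_smul]
          have e4 : (star ((t : ℂ) * Complex.I)) = -((t : ℂ) * Complex.I) := by simp
          have e5 : (t : ℂ) * Complex.I * -((t : ℂ) * Complex.I) = (t : ℂ) ^ 2 := by
            linear_combination (-(t : ℂ) ^ 2) * Complex.I_sq
          rw [e4, e5]
          module
        rw [e3]
        refine (norm_add_le _ _).trans (add_le_add ((norm_mul_le _ _).trans_eq (sq _).symm) ?_)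
        rw [norm_smul]
        rcases subsingleton_or_nontrivial U with _ | _
        · simp [Subsingleton.elim (1 : U) 0, sq_nonneg]
        · simp
      have e6 := hle (p + ((t : ℂ) * Complex.I) • (1 : U))
      rw [e1] at e6
      have e7 : (g p).im + t = (g p + t * Complex.I).im := by simp
      rw [e7]
      refine le_trans ?_ ((pow_le_pow_left₀ (norm_nonneg _) e6 2).trans e2)
      rw [← sq_abs]
      exact pow_le_pow_left₀ (abs_nonneg _) (Complex.abs_im_le_norm _) 2
    by_contra hne
    -- For this `t` the cross term is `2‖p‖²`, so `key` would give `(g p).im ^ 2 + ‖p‖ ^ 2 ≤ 0`.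
    have := key (‖p‖ ^ 2 / (g p).im)
    have e : (g p).im * (‖p‖ ^ 2 / (g p).im) = ‖p‖ ^ 2 := by field_simp
    have hpos : 0 < (g p).im ^ 2 := by positivity
    nlinarith [sq_nonneg ‖p‖]
  have hre : 0 ≤ (g p).re := by
    have hsub : 0 ≤ algebraMap ℝ U ‖p‖ - p :=
      sub_nonneg.mpr (IsSelfAdjoint.le_algebraMap_norm_self (.of_nonneg hp))
    have h2 : ‖algebraMap ℝ U ‖p‖ - p‖ ≤ ‖p‖ :=
      (CStarAlgebra.norm_le_iff_le_algebraMap _ (norm_nonneg p) hsub).mpr (sub_le_self _ hp)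
    have h3 := (Complex.re_le_norm _).trans ((hle _).trans h2)
    have h4 : algebraMap ℝ U ‖p‖ = (‖p‖ : ℂ) • (1 : U) := by
      rw [Algebra.algebraMap_eq_smul_one]; simp
    rw [h4, map_sub, map_smul, h1] at h3
    simp at h3
    exact h3
  exact Complex.nonneg_iff.mpr ⟨hre, him.symm⟩

/-- Every value `‖a⋆ a‖` is attained at a state. -/
theorem exists_state_apply_star_mul_self {C : Type u} [NonUnitalCStarAlgebra C] {a : C}
    (ha : a ≠ 0) : ∃ φ : C →L[ℂ] ℂ, IsState φ ∧ φ (star a * a) = (‖star a * a‖ : ℝ) := by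
  set b : C⁺¹ := ((star a * a : C) : C⁺¹) with hb
  have hbs : b = star (a : C⁺¹) * (a : C⁺¹) := by simp [hb]
  have hb0 : 0 ≤ b := hbs ▸ star_mul_self_nonneg _
  have hnb : ‖b‖ = ‖star a * a‖ := Unitization.norm_inr _
  -- Norming `1 + b` rather than `b` controls both values at once: the real parts of `g 1` and `g b`
  -- are at most `1` and `‖b‖` and add up to `1 + ‖b‖`, so both bounds are attained.
  obtain ⟨g, hg, hgb⟩ := exists_dual_vector'' ℂ (1 + b)
  rw [norm_one_add_of_nonneg hb0, map_add] at hgb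
  have hle : ∀ x, ‖g x‖ ≤ ‖x‖ := fun x => by
    simpa using g.le_of_opNorm_le hg x
  have r1 : (g 1).re ≤ 1 := (Complex.re_le_norm _).trans ((hle 1).trans_eq norm_one)
  have r2 : (g b).re ≤ ‖b‖ := (Complex.re_le_norm _).trans (hle b)
  have r3 : (g 1).re + (g b).re = 1 + ‖b‖ := by simpa using congrArg Complex.re hgb
  have h1 : g 1 = 1 := by
    have e : (g 1).re = 1 := by linarith
    have n : ‖g 1‖ ≤ 1 := (hle 1).trans_eq norm_one
    have s := Complex.sq_norm (g 1)
    rw [Complex.normSq_apply, e] at s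
    have : (g 1).im = 0 := by
      have : (g 1).im ^ 2 ≤ 0 := by nlinarith [norm_nonneg (g 1)]
      nlinarith
    exact Complex.ext e this
  have h2 : g b = (‖b‖ : ℝ) := by
    rw [h1] at hgb
    simpa using hgb
  let ι : C →ₗ[ℂ] C⁺¹ := Unitization.inrHom ℂ ℂ C
  let φ : C →L[ℂ] ℂ := LinearMap.mkContinuous (g.toLinearMap ∘ₗ ι) 1 fun x => by
    rw [one_mul]
    exact (hle _).trans_eq (Unitization.norm_inr _)
  have hφ : ∀ x : C, φ x = g (x : C⁺¹) := fun x => rfl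
  refine ⟨φ, ⟨fun x => ?_, le_antisymm (LinearMap.mkContinuous_norm_le _ zero_le_one _) ?_⟩, ?_⟩
  · rw [hφ, Unitization.inr_mul, Unitization.inr_star]
    exact nonneg_apply_of_unital_contractive hg h1 (star_mul_self_nonneg _)
  -- Restricting to `C` does not lower the norm below one, because `g` attains it at `star a * a`,
  -- which lies in `C`.
  · have h3 := φ.le_opNorm (star a * a)
    rw [hφ, ← hb, h2, Complex.norm_real, norm_norm, hnb] at h3
    have : 0 < ‖star a * a‖ := by
      rw [CStarRing.norm_star_mul_self]
      have := norm_pos_iff.mpr ha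
      positivity
    exact le_of_mul_le_mul_right (by simpa using h3) this
  · rw [hφ, ← hb, h2, hnb]

/-- For `‖a‖ = 1`, some state takes the value one at `(a⋆ a) ^ 3`. -/
theorem exists_state_apply_cube {C : Type u} [NonUnitalCStarAlgebra C] {a : C} (ha : ‖a‖ = 1) :
    ∃ φ : C →L[ℂ] ℂ, IsState φ ∧ φ (star a * a * (star a * a) * (star a * a)) = 1 := by
  set k := star a * a with hk
  have hks : star k = k := by simp [hk]
  have hk1 : ‖k‖ = 1 := by rw [hk, CStarRing.norm_star_mul_self, ha, one_mul]
  have hkk : ‖k * k‖ = 1 := by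
    nth_rewrite 1 [← hks]
    rw [CStarRing.norm_star_mul_self, hk1, one_mul]
  -- The C⋆-identity gives even powers directly; the cube is squeezed between `‖k⁴‖ ≤ ‖k³‖ ‖k‖` and
  -- `‖k³‖ ≤ ‖k²‖ ‖k‖`.
  have hk4 : ‖k * k * k * k‖ = 1 := by
    have : star (k * k) * (k * k) = k * k * k * k := by simp only [star_mul, hks, mul_assoc]
    rw [← this, CStarRing.norm_star_mul_self, hkk, one_mul]
  have hk3 : ‖k * k * k‖ = 1 := by
    refine le_antisymm ?_ ?_
    · simpa [hkk, hk1] using norm_mul_le (k * k) k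
    · simpa [hk4, hk1] using norm_mul_le (k * k * k) k
  have e : star (a * k) * (a * k) = k * k * k := by
    simp only [star_mul, hks]
    simp only [hk, mul_assoc]
  have hne : a * k ≠ 0 := by
    intro h
    rw [← e, h] at hk3
    simp at hk3
  obtain ⟨φ, hφ, h⟩ := exists_state_apply_star_mul_self hne
  exact ⟨φ, hφ, by rw [← e, h, e, hk3]; simp⟩

/-! ### Elementary tensors -/

section

variable {C : Type u} {D : Type v} [NonUnitalCStarAlgebra C] [NonUnitalCStarAlgebra D]

theorem stateNorm_tmul_sq {φ : C →L[ℂ] ℂ} {ψ : D →L[ℂ] ℂ} (hφ : IsState φ) (hψ : IsState ψ)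
    (c : C) (d : D) :
    ((stateNorm φ ψ (tmul c d) ^ 2 : ℝ) : ℂ) = φ (star c * c) * ψ (star d * d) := by
  rw [← (stateNorm_props hφ hψ).2.2.2, star_tmul, tmul_mul_tmul, prodFunctional_tmul]

theorem IsState.norm_apply_le {φ : C →L[ℂ] ℂ} (hφ : IsState φ) (x : C) : ‖φ x‖ ≤ ‖x‖ := by
  simpa [hφ.norm_eq_one] using φ.le_opNorm x

theorem stateNorm_tmul_le_one {φ : C →L[ℂ] ℂ} {ψ : D →L[ℂ] ℂ} (hφ : IsState φ) (hψ : IsState ψ)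
    {c : C} {d : D} (hc : ‖c‖ ≤ 1) (hd : ‖d‖ ≤ 1) : stateNorm φ ψ (tmul c d) ≤ 1 := by
  have h := congrArg norm (stateNorm_tmul_sq hφ hψ c d)
  rw [Complex.norm_real, Real.norm_of_nonneg (sq_nonneg _), norm_mul] at h
  have h1 : ‖φ (star c * c)‖ ≤ 1 := (hφ.norm_apply_le _).trans <| by
    rw [CStarRing.norm_star_mul_self]; exact mul_le_one₀ hc (norm_nonneg _) hc
  have h2 : ‖ψ (star d * d)‖ ≤ 1 := (hψ.norm_apply_le _).trans <| by
    rw [CStarRing.norm_star_mul_self]; exact mul_le_one₀ hd (norm_nonneg _) hd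
  have h3 := mul_le_one₀ h1 (norm_nonneg _) h2
  rw [← h] at h3
  exact (sq_le_one_iff₀ (stateNorm_nonneg _ _ _)).mp h3

/-- Elementary tensors act on each product GNS space with norm at most `‖c‖ * ‖d‖`. Only this half
of the cross-norm identity is needed. -/
theorem norm_tmul_le (c : C) (d : D) : ‖tmul c d‖ ≤ ‖c‖ * ‖d‖ := by
  refine minNorm_le (by positivity) fun φ ψ hφ hψ w => ?_
  obtain ⟨H, _, _, V, hV, hb⟩ := exists_gns_prod hφ hψ
  have hn : ∀ x, stateNorm φ ψ x = ‖V x‖ := by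
    intro x
    rw [stateNorm, ← hV, norm_eq_sqrt_re_inner (𝕜 := ℂ)]
    rfl
  rw [hn, hn]
  exact hb c d w

/-! ### Slice maps -/

/-- The slice map `c ⊗ d ↦ ψ (e⋆ d e) c` on the algebraic tensor product. -/
def algSlice (ψ : D →L[ℂ] ℂ) (e : D) : AlgTensor C D →ₗ[ℂ] C :=
  (TensorProduct.rid ℂ C).toLinearMap ∘ₗ TensorProduct.map LinearMap.id
    (ψ.toLinearMap ∘ₗ LinearMap.mulLeft ℂ (star e) ∘ₗ LinearMap.mulRight ℂ e)

theorem algSlice_tmul (ψ : D →L[ℂ] ℂ) (e : D) (c : C) (d : D) :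
    algSlice ψ e (tmul c d) = ψ (star e * (d * e)) • c := by
  change (TensorProduct.rid ℂ C) (TensorProduct.map LinearMap.id
    (ψ.toLinearMap ∘ₗ LinearMap.mulLeft ℂ (star e) ∘ₗ LinearMap.mulRight ℂ e) (c ⊗ₜ[ℂ] d)) = _
  simp

/-- Matrix coefficients of the slice at `v`, `w` are those of `z` at `v ⊗ e`, `w ⊗ e`, which the
minimal norm controls. -/
theorem apply_mul_algSlice_mul (φ : C →L[ℂ] ℂ) (ψ : D →L[ℂ] ℂ) (e : D) (v w : C)
    (z : AlgTensor C D) :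
    φ (star v * (algSlice ψ e z * w)) =
      prodFunctional φ ψ (star (tmul v e) * (z * tmul w e)) := by
  induction z using alg_induction with
  | h0 => simp
  | ha x y hx hy => rw [map_add, add_mul, mul_add, map_add, hx, hy, add_mul, mul_add, map_add]
  | ht c d =>
    rw [algSlice_tmul, star_tmul, tmul_mul_tmul, tmul_mul_tmul, prodFunctional_tmul,
      smul_mul_assoc, mul_smul_comm, map_smul, smul_eq_mul, mul_comm]

/-- With `c = ‖c‖ a`, `k = a⋆a` and `φ (k³) = 1`, the coefficient of the slice `c` at the vectors
`ak`, `k` is exactly `‖c‖`. Cauchy-Schwarz for `φ ⊗ ψ` bounds it by `‖z‖`. -/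
theorem norm_algSlice_le {ψ : D →L[ℂ] ℂ} (hψ : IsState ψ) {e : D} (he : ‖e‖ ≤ 1)
    (z : AlgTensor C D) : ‖algSlice ψ e z‖ ≤ ‖z‖ := by
  set c := algSlice ψ e z with hc
  by_cases hc0 : c = 0
  · simp [hc0]
  have hcn : ‖c‖ ≠ 0 := norm_ne_zero_iff.mpr hc0
  set a : C := ((‖c‖ : ℂ)⁻¹) • c with ha
  have ha1 : ‖a‖ = 1 := by
    rw [ha, norm_smul, norm_inv, Complex.norm_real, norm_norm, inv_mul_cancel₀ hcn]
  have hca : c = (‖c‖ : ℂ) • a := by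
    rw [ha, smul_smul, mul_inv_cancel₀ (by exact_mod_cast hcn), one_smul]
  obtain ⟨φ, hφ, h⟩ := exists_state_apply_cube ha1
  set k := star a * a with hk
  have hk1 : ‖k‖ = 1 := by rw [hk, CStarRing.norm_star_mul_self, ha1, one_mul]
  have key := apply_mul_algSlice_mul φ ψ e (a * k) k z
  have e1 : star (a * k) * (c * k) = (‖c‖ : ℂ) • (k * k * k) := by
    nth_rewrite 1 [hca]
    simp only [smul_mul_assoc, mul_smul_comm, star_mul, hk, star_star, mul_assoc]
  rw [← hc, e1, map_smul, h, smul_eq_mul, mul_one] at key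
  have hb := (stateNorm_props hφ hψ).2.2.1 (tmul (a * k) e) (z * tmul k e)
  rw [← key, Complex.norm_real, norm_norm] at hb
  have h1 : stateNorm φ ψ (tmul (a * k) e) ≤ 1 :=
    stateNorm_tmul_le_one hφ hψ (by simpa [ha1, hk1] using norm_mul_le a k) he
  have h2 : stateNorm φ ψ (tmul k e) ≤ 1 := stateNorm_tmul_le_one hφ hψ hk1.le he
  calc ‖c‖ ≤ stateNorm φ ψ (tmul (a * k) e) * stateNorm φ ψ (z * tmul k e) := hb
    _ ≤ 1 * (‖z‖ * 1) := by
      refine mul_le_mul h1 ((stateNorm_mul_le hφ hψ z _).trans ?_) (stateNorm_nonneg _ _ _)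
        zero_le_one
      exact mul_le_mul_of_nonneg_left h2 (minNorm_nonneg z)
    _ = ‖z‖ := by ring

variable (C D) in
/-- There are `h` in the unit ball of `D` and a contractive slice map `C ⊗min D → C` sending
`c ⊗ h` to `c` and `c ⊗ d` to a multiple of `c`. -/
theorem exists_slice [Nontrivial D] :
    ∃ (h : D) (S : MinTensor C D →L[ℂ] C), ‖h‖ ≤ 1 ∧ (∀ z, ‖S z‖ ≤ ‖z‖) ∧
      (∀ c, S (ofAlg (tmul c h)) = c) ∧ ∀ c d, ∃ r : ℂ, S (ofAlg (tmul c d)) = r • c := by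
  obtain ⟨d, hd⟩ := exists_norm_eq D zero_le_one
  obtain ⟨ψ, hψ, hψ1⟩ := exists_state_apply_cube hd
  set h := star d * d with hh
  have hs : star h = h := by simp [hh]
  have hh1 : ‖h‖ ≤ 1 := by rw [hh, CStarRing.norm_star_mul_self, hd, one_mul]
  let T : AlgTensor C D →L[ℂ] C := (algSlice ψ h).mkContinuous 1 fun z => by
    rw [one_mul]; exact norm_algSlice_le hψ hh1 z
  let S : MinTensor C D →L[ℂ] C := T.extend (ofAlg (C := C) (D := D)).toContinuousLinearMap
  have hS : ∀ z, S (ofAlg z) = algSlice ψ h z := fun z =>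
    T.extend_eq denseRange_ofAlg (ofAlg (C := C) (D := D)).isometry.isUniformInducing z
  refine ⟨h, S, hh1, fun z => ?_, fun c => ?_, fun c d => ⟨_, (hS _).trans (algSlice_tmul ..)⟩⟩
  · induction z using min_induction with
    | hp => exact isClosed_le (by fun_prop) (by fun_prop)
    | h z =>
      rw [hS, ofAlg.norm_map]
      exact norm_algSlice_le hψ hh1 z
  -- The coefficient of `c` is `ψ (h³) = 1`.
  · rw [hS, algSlice_tmul, hs, ← mul_assoc, hψ1, one_smul]

theorem tmul_mem_minTensorSub {A : NonUnitalStarSubalgebra ℂ C} {a : C} (ha : a ∈ A) (d : D) :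
    ofAlg (tmul a d) ∈ minTensorSub A D :=
  subset_closure (Submodule.subset_span ⟨a, ha, d, rfl⟩)

/-- The span of the elementary tensors maps into `A`, and finite dimension makes `A` closed, so the
closure does too. This is the only use of finite dimension. -/
theorem map_mem_of_mem_minTensorSub (A : NonUnitalStarSubalgebra ℂ C) [FiniteDimensional ℂ A]
    {S : MinTensor C D →L[ℂ] C} (hS : ∀ c d, ∃ r : ℂ, S (ofAlg (tmul c d)) = r • c)
    {z : MinTensor C D} (hz : z ∈ minTensorSub A D) : S z ∈ A := by
  have hfin : FiniteDimensional ℂ A.toSubmodule := ‹FiniteDimensional ℂ A›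
  have hclosed : IsClosed (A : Set C) := A.toSubmodule.closed_of_finiteDimensional
  have hspan : Submodule.span ℂ {x : MinTensor C D | ∃ a ∈ A, ∃ d : D, x = ofAlg (tmul a d)} ≤
      A.toSubmodule.comap S.toLinearMap := by
    rw [Submodule.span_le]
    rintro _ ⟨a, ha, d, rfl⟩
    obtain ⟨r, hr⟩ := hS a d
    change S (ofAlg (tmul a d)) ∈ A
    rw [hr]
    exact A.smul_mem r ha
  exact closure_minimal (t := S ⁻¹' (A : Set C)) hspan (hclosed.preimage S.continuous) hz

end

/-! ### Distances -/

section

variable {C : Type u} [NonUnitalCStarAlgebra C]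

theorem zero_mem_unitBall (A : NonUnitalStarSubalgebra ℂ C) : (0 : C) ∈ unitBall A :=
  ⟨zero_mem A, by simp⟩

theorem isBounded_unitBall (A : NonUnitalStarSubalgebra ℂ C) : Bornology.IsBounded (unitBall A) :=
  Metric.isBounded_closedBall.subset fun _ hx => mem_closedBall_zero_iff.mpr hx.2

/-- The real Hausdorff distance defaults to `0` when the extended one is infinite; non-empty bounded
balls exclude this. -/
theorem exists_dist_lt_of_dKK_lt {A B : NonUnitalStarSubalgebra ℂ C} {r : ℝ} (hr : dKK A B < r)
    {x : C} (hx : x ∈ unitBall A) : ∃ y ∈ unitBall B, dist x y < r :=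
  Metric.exists_dist_lt_of_hausdorffDist_lt hx hr <|
    Metric.hausdorffEDist_ne_top_of_nonempty_of_bounded ⟨0, zero_mem_unitBall A⟩
      ⟨0, zero_mem_unitBall B⟩ (isBounded_unitBall A) (isBounded_unitBall B)

theorem dKK_comm (A B : NonUnitalStarSubalgebra ℂ C) : dKK A B = dKK B A :=
  Metric.hausdorffDist_comm

theorem nearInclusion_one (A B : NonUnitalStarSubalgebra ℂ C) : NearInclusion A B 1 :=
  fun _ hx => ⟨0, zero_mem B, by simpa using hx.2⟩

end

end CStarDist

end

/-! ### Pulling approximations back along the slice map -/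

theorem proposition4p3 {C : Type*} {D : Type*} [NonUnitalCStarAlgebra C]
    [NonUnitalCStarAlgebra D] [Nontrivial D] (A B : NonUnitalStarSubalgebra ℂ C)
    [FiniteDimensional ℂ A] [FiniteDimensional ℂ B] :
    CStarDist.dKK A B ≤
        CStarDist.dKK (CStarDist.minTensorSub A D) (CStarDist.minTensorSub B D) ∧
      CStarDist.d₀ A B ≤
        CStarDist.d₀ (CStarDist.minTensorSub A D) (CStarDist.minTensorSub B D) := by
  obtain ⟨h, S, hh, hSn, hSh, hSr⟩ := CStarDist.exists_slice C D
  have hball : ∀ (A' : NonUnitalStarSubalgebra ℂ C) {x : C}, x ∈ CStarDist.unitBall A' →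
      CStarDist.ofAlg (CStarDist.tmul x h) ∈
        CStarDist.unitBall (CStarDist.minTensorSub A' D) := fun A' x hx =>
    ⟨CStarDist.tmul_mem_minTensorSub hx.1 h, by
      rw [LinearIsometry.norm_map]
      exact (CStarDist.norm_tmul_le x h).trans (mul_le_one₀ hx.2 (norm_nonneg _) hh)⟩
  -- Here `x - S z = S (x ⊗ h - z)`, and `S` is contractive.
  have hdist : ∀ (x : C) (z : CStarDist.MinTensor C D),
      ‖x - S z‖ ≤ ‖CStarDist.ofAlg (CStarDist.tmul x h) - z‖ := fun x z => by
    simpa [hSh] using hSn (CStarDist.ofAlg (CStarDist.tmul x h) - z)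
  constructor
  · have hKK : ∀ (A' B' : NonUnitalStarSubalgebra ℂ C) [FiniteDimensional ℂ B'] {r : ℝ},
        CStarDist.dKK (CStarDist.minTensorSub A' D) (CStarDist.minTensorSub B' D) < r →
        ∀ x ∈ CStarDist.unitBall A', ∃ y ∈ CStarDist.unitBall B', dist x y ≤ r := by
      intro A' B' _ r hr x hx
      obtain ⟨z, hz, hlt⟩ := CStarDist.exists_dist_lt_of_dKK_lt hr (hball A' hx)
      refine ⟨S z, ⟨CStarDist.map_mem_of_mem_minTensorSub B' hSr hz.1, (hSn z).trans hz.2⟩, ?_⟩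
      rw [dist_eq_norm] at hlt ⊢
      exact (hdist x z).trans hlt.le
    -- The infimum over the ball need not be attained, so approximants are taken for each strictly
    -- larger `r`.
    refine le_of_forall_gt_imp_ge_of_dense fun r hr => ?_
    exact Metric.hausdorffDist_le_of_mem_dist (Metric.hausdorffDist_nonneg.trans hr.le)
      (hKK A B hr) (hKK B A (by rwa [CStarDist.dKK_comm]))
  · have hNear : ∀ (A' B' : NonUnitalStarSubalgebra ℂ C) [FiniteDimensional ℂ B'] {γ : ℝ},
        CStarDist.NearInclusion (CStarDist.minTensorSub A' D) (CStarDist.minTensorSub B' D) γ →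
        CStarDist.NearInclusion A' B' γ := by
      intro A' B' _ γ hγ x hx
      obtain ⟨z, hz, hle⟩ := hγ _ (hball A' hx)
      exact ⟨S z, CStarDist.map_mem_of_mem_minTensorSub B' hSr hz, (hdist x z).trans hle⟩
    -- Every constant admissible for the tensor products is admissible for `A` and `B`. The witness
    -- `1` is required because the real infimum of the empty set is `0`.
    exact csInf_le_csInf ⟨0, fun γ hγ => hγ.1.le⟩
      ⟨1, one_pos, CStarDist.nearInclusion_one _ _, CStarDist.nearInclusion_one _ _⟩
      fun γ hγ => ⟨hγ.1, hNear A B hγ.2.1, hNear B A hγ.2.2⟩
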